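/- Let $p$ be an odd prime number and let $E$ be an elliptic curve over $\mathbb{Q}$. Let $G_{\mathbb{Q}}=\mathrm{Gal}(\overline{\mathbb{Q}}/\mathbb{Q})$, let $T_p(E)=\varprojlim_n E[p^n]$ be the $p$-adic Tate module of $E$, where $E[p^n]$ is the group of $p^n$-torsion points of $E(\overline{\mathbb{Q}})$, let $\mathbb{Q}(\mu_{p^\infty})\subseteq\overline{\mathbb{Q}}$ be the field generated over $\mathbb{Q}$ by all roots of unity of $p$-power order, and put $G_{\mathbb{Q}(\mu_{p^\infty})}=\mathrm{Gal}(\overline{\mathbb{Q}}/\mathbb{Q}(\mu_{p^\infty}))$. If the Galois representation $\rho^E\colon G_{\mathbb{Q}}\longrightarrow \mathrm{Aut}_{\mathbb{Z}_p}(T_p(E))\simeq GL_2(\mathbb{Z}_p)$ is surjective, then the restriction to $G_{\mathbb{Q}(\mu_{p^\infty})}$ of the mod $p$ Galois representation, $\rho^E_1\colon G_{\mathbb{Q}(\mu_{p^\infty})}\longrightarrow \mathrm{Aut}_{\mathbb{F}_p}(E[p])\simeq GL_2(\mathbb{F}_p)$, is absolutely irreducible over $\mathbb{F}_p$; that is,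 for every field extension $L/\mathbb{F}_p$ the representation of $G_{\mathbb{Q}(\mu_{p^\infty})}$ on $L\otimes_{\mathbb{F}_p}E[p]$ is irreducible. -/

import Mathlib

open scoped TensorProduct WeierstrassCurve.Affine

namespace TateGalois

section TateModule

variable (p : ℕ) (A : Type*) [AddCommGroup A]

/-- The `p`-adic Tate module `lim A[p ^ n]` of an abelian group `A`, with multiplication by `p` as
transition maps, realised as the group of compatible sequences. -/
def tateModule : AddSubgroup (ℕ → A) where
  carrier := {a | ∀ n, p ^ n • a n = 0 ∧ p • a (n + 1) = a n}
  zero_mem' n := by simp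
  add_mem' {a b} ha hb n := by
    simp [smul_add, (ha n).1, (hb n).1, (ha n).2, (hb n).2]
  neg_mem' {a} ha n := by
    simp [smul_neg, (ha n).1, (ha n).2]

variable {p A}

theorem nsmul_eq_of_natCast_eq {n : ℕ} {x : A} (hx : p ^ n • x = 0) {k l : ℕ}
    (h : (k : ZMod (p ^ n)) = l) : k • x = l • x := by
  rw [ZMod.natCast_eq_natCast_iff] at h
  have key : addOrderOf x ∣ p ^ n := addOrderOf_dvd_of_nsmul_eq_zero hx
  exact nsmul_eq_nsmul_iff_modEq.mpr (h.of_dvd key)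

variable [Fact p.Prime]

/-- A `p`-adic integer `z` acts on the component in `A[p ^ n]` through its residue in
`ℤ / p ^ n`. -/
noncomputable instance : SMul ℤ_[p] (tateModule p A) where
  smul z a := ⟨fun n => (PadicInt.toZModPow n z).val • a.1 n, fun n => by
    refine ⟨?_, ?_⟩
    · rw [smul_comm, (a.2 n).1, smul_zero]
    · rw [smul_comm, (a.2 n).2]
      refine nsmul_eq_of_natCast_eq (a.2 n).1 ?_
      rw [ZMod.natCast_zmod_val, ← PadicInt.cast_toZModPow n (n + 1) (Nat.le_succ n) z,
        ZMod.natCast_val]⟩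

theorem smul_apply (z : ℤ_[p]) (a : tateModule p A) (n : ℕ) :
    (z • a).1 n = (PadicInt.toZModPow n z).val • a.1 n := rfl

noncomputable instance : Module ℤ_[p] (tateModule p A) where
  one_smul a := by
    refine Subtype.ext (funext fun n => ?_)
    rw [smul_apply]
    conv_rhs => rw [← one_smul ℕ (a.1 n)]
    exact nsmul_eq_of_natCast_eq (a.2 n).1 (by simp)
  mul_smul z w a := by
    refine Subtype.ext (funext fun n => ?_)
    rw [smul_apply, smul_apply, smul_apply, smul_smul]
    exact nsmul_eq_of_natCast_eq (a.2 n).1 (by simp)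
  smul_zero z := by
    refine Subtype.ext (funext fun n => ?_)
    rw [smul_apply]
    exact smul_zero _
  smul_add z a b := by
    refine Subtype.ext (funext fun n => ?_)
    exact smul_add _ _ _
  add_smul z w a := by
    refine Subtype.ext (funext fun n => ?_)
    rw [smul_apply]
    change _ = (PadicInt.toZModPow n z).val • a.1 n + (PadicInt.toZModPow n w).val • a.1 n
    rw [← add_smul]
    exact nsmul_eq_of_natCast_eq (a.2 n).1 (by simp)
  zero_smul a := by
    refine Subtype.ext (funext fun n => ?_)
    rw [smul_apply]
    simp

/-- The endomorphism of the Tate module induced, component by component, by an endomorphism of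
the group. -/
noncomputable def tateMap (f : A →+ A) : tateModule p A →ₗ[ℤ_[p]] tateModule p A where
  toFun a := ⟨fun n => f (a.1 n), fun n => by
    rw [← map_nsmul, ← map_nsmul, (a.2 n).1, (a.2 n).2, map_zero]; exact ⟨rfl, rfl⟩⟩
  map_add' a b := Subtype.ext (funext fun n => map_add f _ _)
  map_smul' z a := Subtype.ext (funext fun n => map_nsmul f _ _)

end TateModule

section AbsolutelyIrreducible

universe u v w

/-- The extension of scalars of a representation over `k` to a field extension `L` of `k`. -/
noncomputable def baseChangeRep {k : Type u} {G : Type v} {V : Type w} [Field k] [Monoid G]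
    [AddCommGroup V] [Module k V] (ρ : Representation k G V) (L : Type u) [Field L] [Algebra k L] :
    Representation L G (L ⊗[k] V) :=
  (Module.End.baseChangeHom k L V : Module.End k V →* Module.End L (L ⊗[k] V)).comp ρ

/-- A representation over a field `k` is absolutely irreducible if it stays irreducible after
extension of scalars to every field extension of `k`. -/
def IsAbsolutelyIrreducible {k : Type u} {G : Type v} {V : Type w} [Field k] [Monoid G]
    [AddCommGroup V] [Module k V] (ρ : Representation k G V) : Prop :=
  ∀ (L : Type u) [Field L] [Algebra k L], (baseChangeRep ρ L).IsIrreducible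

end AbsolutelyIrreducible

section EllipticCurve

/-- An algebraic closure of `ℚ`. -/
abbrev QBar : Type := AlgebraicClosure ℚ

/-- Classical decidability of equality, used by the addition law on points. -/
noncomputable instance : DecidableEq QBar := Classical.decEq _

/-- The absolute Galois group `G_ℚ`. -/
abbrev GQ : Type := QBar ≃ₐ[ℚ] QBar

/-- The field `ℚ(μ_{p^∞})` generated by all `p`-power roots of unity. -/
noncomputable def cyclotomicTower (p : ℕ) : IntermediateField ℚ QBar :=
  IntermediateField.adjoin ℚ {ζ : QBar | ∃ n : ℕ, ζ ^ p ^ n = 1}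

variable (E : WeierstrassCurve ℚ)

/-- The group `E(ℚ̄)` of geometric points of `E`. -/
abbrev GeomPoint : Type := (E⁄QBar).Point

/-- The action of `G_ℚ` on `E(ℚ̄)`, by `σ (x, y) = (σ x, σ y)`. -/
noncomputable def galPoint : GQ →* AddMonoid.End (GeomPoint E) where
  toFun σ := WeierstrassCurve.Affine.Point.map (W' := E) σ.toAlgHom
  map_one' := by
    ext P
    cases P <;> rfl
  map_mul' σ τ := by
    ext P
    cases P <;> rfl

/-- The `p`-torsion `E[p]` of `E(ℚ̄)`. -/
abbrev torsionP (p : ℕ) : Type := AddSubgroup.torsionBy (GeomPoint E) (p : ℤ)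

/-- `E[p]` as a vector space over the field with `p` elements. -/
noncomputable instance (p : ℕ) : Module (ZMod p) (torsionP E p) :=
  AddSubgroup.torsionBy.zmodModule

/-- The mod `p` Galois representation `G_ℚ → Aut(E[p])`. -/
noncomputable def modPRep (p : ℕ) : Representation (ZMod p) GQ (torsionP E p) where
  toFun σ := AddMonoidHom.toZModLinearMap p
    (((galPoint E σ).comp (AddSubgroup.torsionBy (GeomPoint E) (p : ℤ)).subtype).codRestrict
      (AddSubgroup.torsionBy (GeomPoint E) (p : ℤ)) fun P => by
        have h : (p : ℤ) • (P : GeomPoint E) = 0 := P.2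
        change (p : ℤ) • galPoint E σ (P : GeomPoint E) = 0
        rw [← map_zsmul, h, map_zero])
  map_one' := by
    refine LinearMap.ext fun P => Subtype.ext ?_
    change galPoint E 1 (P : GeomPoint E) = P
    rw [map_one]; rfl
  map_mul' σ τ := by
    refine LinearMap.ext fun P => Subtype.ext ?_
    change galPoint E (σ * τ) (P : GeomPoint E) = galPoint E σ (galPoint E τ P)
    rw [map_mul]; rfl

/-- The restriction of the mod `p` Galois representation to `G_{ℚ(μ_{p^∞})}`. -/
noncomputable def modPRepCyclotomic (p : ℕ) :
    Representation (ZMod p) (cyclotomicTower p).fixingSubgroup (torsionP E p) :=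
  (modPRep E p).comp (cyclotomicTower p).fixingSubgroup.subtype

/-- The `p`-adic Galois representation `G_ℚ → Aut(T_p(E))`. -/
noncomputable def pAdicRep (p : ℕ) [Fact p.Prime] :
    GQ →* (tateModule p (GeomPoint E) ≃ₗ[ℤ_[p]] tateModule p (GeomPoint E)) where
  toFun σ := LinearEquiv.ofLinearMap (tateMap (galPoint E σ)) (tateMap (galPoint E σ⁻¹))
    (by
      refine LinearMap.ext fun a => Subtype.ext (funext fun n => ?_)
      change (galPoint E σ * galPoint E σ⁻¹) (a.1 n) = a.1 n
      rw [← map_mul, mul_inv_cancel, map_one]; rfl)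
    (by
      refine LinearMap.ext fun a => Subtype.ext (funext fun n => ?_)
      change (galPoint E σ⁻¹ * galPoint E σ) (a.1 n) = a.1 n
      rw [← map_mul, inv_mul_cancel, map_one]; rfl)
  map_one' := by
    refine LinearEquiv.ext fun a => Subtype.ext (funext fun n => ?_)
    change galPoint E 1 (a.1 n) = a.1 n
    rw [map_one]; rfl
  map_mul' σ τ := by
    refine LinearEquiv.ext fun a => Subtype.ext (funext fun n => ?_)
    change galPoint E (σ * τ) (a.1 n) = galPoint E σ (galPoint E τ (a.1 n))
    rw [map_mul]; rfl

end EllipticCurve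

end TateGalois

/-! A commutator in `GQ` fixes every root of unity, because Galois acts on those through commuting
power maps. So the image of `G_{ℚ(μ_{p^∞})}` contains every commutator of the `p`-adic image, which
by hypothesis is all of `Aut (T_p E)`. Neither the Weil pairing nor the determinant is needed. Fix a
basis `b` of `T_p E` lifting a basis of `E[p]` (`exists_basis_lift`). If `D` doubles `b j` and `e`
is the elementary transvection sending `b i` to `b i + b j`, then `D e D⁻¹ = e²`, so `e` is the
commutator of `D` and `e`; `D` is invertible because `p` is odd
(`exists_commutator_eq_transvection`). All elementary transvections thus act on `E[p]`, and they
leave no proper nonzero subspace over any field (`isAbsolutelyIrreducible_of_transvections`). About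
`E` only this is needed: `E[p]` is finite and nonzero, and `E(ℚ̄)` is `p`-divisible; that the rank
is 2 plays no role. These facts follow from polynomials of known degree and leading coefficient
computing `x(nP)`, built by recursion on `n` (`IsSMulPair.exists_add_two`). -/

namespace WeierstrassCurve.Affine.Point

/-! ### Sums and differences of points in terms of `x`-coordinates -/

section AddSub

theorem eval_addSubMap {F : Type*} [Field F] (W : WeierstrassCurve F) (s t u : F) :
    (fun i => (addSubMap W i).eval ![s, t, u]) =
      ![s ^ 2 - W.b₄ * s * u - W.b₆ * t * u - W.b₈ * u ^ 2,
        2 * t * s + W.b₂ * s * u + W.b₄ * t * u + W.b₆ * u ^ 2, t ^ 2 - 4 * s * u] := by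
  funext i
  fin_cases i <;> simp [addSubMap]

variable {F : Type*} [Field F] [DecidableEq F] {W : WeierstrassCurve.Affine F}

/-- This is the duplication formula. At a point of order two the last two coordinates vanish, and
the first is nonzero because the map has no base points on an elliptic curve. -/
theorem exists_addSubMap_sym2x_self [W.IsElliptic] (P : W.Point) :
    ∃ c : F, c ≠ 0 ∧
      (fun i => (addSubMap W i).eval (P.sym2x P)) = c • (P + P).sym2x 0 := by
  have hne : (fun i => (addSubMap W i).eval (P.sym2x P)) ≠ 0 :=
    addSubMap_ne_zero W (sym2x_ne_zero P P)
  rcases P with _ | ⟨x, y, h⟩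
  · refine ⟨1, one_ne_zero, ?_⟩
    rw [← zero_def, add_zero, sym2x_zero_zero, eval_addSubMap]
    simp
  · rw [sym2x_some_some, eval_addSubMap] at hne ⊢
    have he := (W.equation_iff x y).mp h.1
    by_cases hy : y = W.negY x y
    · rw [add_self_of_Y_eq hy, sym2x_zero_zero]
      have h1 : 2 * (x + x) * (x * x) + W.b₂ * (x * x) * 1 + W.b₄ * (x + x) * 1 + W.b₆ * 1 ^ 2
          = 0 := by
        have : (2 * y + W.a₁ * x + W.a₃) = 0 := by rw [negY] at hy; linear_combination hy
        simp only [b₂, b₄, b₆]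
        linear_combination (2 * y + W.a₁ * x + W.a₃) * this - 4 * he
      have h2 : (x + x) ^ 2 - 4 * (x * x) * 1 = 0 := by ring
      rw [h1, h2] at hne ⊢
      refine ⟨(x * x) ^ 2 - W.b₄ * (x * x) * 1 - W.b₆ * (x + x) * 1 - W.b₈ * 1 ^ 2,
        fun h0 => hne ?_, ?_⟩
      · rw [h0]; simp
      · simp
    · rw [add_self_of_Y_ne hy, sym2x_some_zero]
      have hd : y - W.negY x y ≠ 0 := sub_ne_zero.mpr hy
      refine ⟨(y - W.negY x y) ^ 2, pow_ne_zero 2 hd, ?_⟩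
      rw [slope_of_Y_ne rfl hy]
      simp only [Matrix.smul_cons, smul_eq_mul, Matrix.smul_empty, mul_one, mul_zero]
      congr 1
      · rw [addX]
        field_simp
        simp only [b₄, b₆, b₈, negY]
        linear_combination (W.a₁ ^ 2 + 4 * W.a₂ + 8 * x) * he
      congr 1
      · simp only [b₂, b₄, b₆, negY]
        linear_combination -4 * he
      · congr 1; ring

/-- The symmetric functions of `x(P + Q)` and `x(P - Q)` are quadratic in those of `x(P)` and
`x(Q)`. The cases `P = ±Q` reduce to duplication; two affine points with distinct `x` use the chord
formulas. -/
theorem exists_addSubMap_sym2x [W.IsElliptic] (P Q : W.Point) :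
    ∃ c : F, c ≠ 0 ∧
      (fun i => (addSubMap W i).eval (P.sym2x Q)) = c • (P + Q).sym2x (P - Q) := by
  by_cases hPQ : P = Q
  · subst hPQ; rw [sub_self]; exact exists_addSubMap_sym2x_self P
  by_cases hPQ' : P = -Q
  · subst hPQ'
    obtain ⟨c, hc, h⟩ := exists_addSubMap_sym2x_self (-Q)
    refine ⟨c, hc, ?_⟩
    rw [sym2x_neg_right] at h
    rw [h, neg_add_cancel, sub_eq_add_neg, sym2x_comm]
  rcases P with _ | ⟨x₁, y₁, h₁⟩
  · rcases Q with _ | ⟨x, y, h⟩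
    · exact absurd rfl hPQ
    · refine ⟨1, one_ne_zero, ?_⟩
      rw [← zero_def, zero_add, zero_sub, sym2x_neg_right, sym2x_zero_some, sym2x_some_some,
        eval_addSubMap]
      simp; constructor <;> ring
  · rcases Q with _ | ⟨x₂, y₂, h₂⟩
    · refine ⟨1, one_ne_zero, ?_⟩
      rw [← zero_def, add_zero, sub_zero, sym2x_some_zero, sym2x_some_some, eval_addSubMap]
      simp; constructor <;> ring
    · have hx : x₁ ≠ x₂ := fun hx => by
        rcases X_eq_iff.mp hx with h | h
        exacts [hPQ h, hPQ' h]
      have hd : x₁ - x₂ ≠ 0 := sub_ne_zero.mpr hx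
      have he₁ := (W.equation_iff x₁ y₁).mp h₁.1
      have he₂ := (W.equation_iff x₂ y₂).mp h₂.1
      refine ⟨(x₁ - x₂) ^ 2, pow_ne_zero 2 hd, ?_⟩
      rw [sub_eq_add_neg (some x₁ y₁ h₁), neg_some, add_of_X_ne hx, add_of_X_ne hx, sym2x_some_some,
        sym2x_some_some, eval_addSubMap, slope_of_X_ne hx, slope_of_X_ne hx]
      simp only [Matrix.smul_cons, smul_eq_mul, Matrix.smul_empty, mul_one]
      have hS : (y₁ - y₂) * (y₁ - y₂ + W.a₁ * (x₁ - x₂)) + (y₁ - W.negY x₂ y₂) *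
          (y₁ - W.negY x₂ y₂ + W.a₁ * (x₁ - x₂)) =
          2 * (x₁ ^ 3 + W.a₂ * x₁ ^ 2 + W.a₄ * x₁ + W.a₆) +
          2 * (x₂ ^ 3 + W.a₂ * x₂ ^ 2 + W.a₄ * x₂ + W.a₆) + (W.a₁ * x₂ + W.a₃) ^ 2 +
          W.a₁ * (x₁ - x₂) * (W.a₁ * x₂ + W.a₃) := by
        rw [negY]
        linear_combination 2 * he₁ + 2 * he₂
      -- The product of the slope terms of `P + Q` and `P - Q` is regrouped crosswise here and in
      -- `hB`: each mixed product loses `y₁` by the curve equations.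
      have hA : (y₁ - y₂) * (y₁ - W.negY x₂ y₂ + W.a₁ * (x₁ - x₂)) =
          (x₁ ^ 3 + W.a₂ * x₁ ^ 2 + W.a₄ * x₁ + W.a₆) -
          (x₂ ^ 3 + W.a₂ * x₂ ^ 2 + W.a₄ * x₂ + W.a₆) - W.a₁ * (x₁ - x₂) * y₂ := by
        rw [negY]
        linear_combination he₁ - he₂
      have hB : (y₁ - y₂ + W.a₁ * (x₁ - x₂)) * (y₁ - W.negY x₂ y₂) =
          (x₁ ^ 3 + W.a₂ * x₁ ^ 2 + W.a₄ * x₁ + W.a₆) -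
          (x₂ ^ 3 + W.a₂ * x₂ ^ 2 + W.a₄ * x₂ + W.a₆) +
          W.a₁ * (x₁ - x₂) * (y₂ + W.a₁ * x₂ + W.a₃) := by
        rw [negY]
        linear_combination he₁ - he₂
      have e₁ : W.addX x₁ x₂ ((y₁ - y₂) / (x₁ - x₂)) = ((y₁ - y₂) * (y₁ - y₂ + W.a₁ * (x₁ - x₂))
          - (W.a₂ + x₁ + x₂) * (x₁ - x₂) ^ 2) / (x₁ - x₂) ^ 2 := by
        rw [addX]; field_simp; ring
      have e₂ : W.addX x₁ x₂ ((y₁ - W.negY x₂ y₂) / (x₁ - x₂)) =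
          ((y₁ - W.negY x₂ y₂) * (y₁ - W.negY x₂ y₂ + W.a₁ * (x₁ - x₂))
          - (W.a₂ + x₁ + x₂) * (x₁ - x₂) ^ 2) / (x₁ - x₂) ^ 2 := by
        rw [addX]; field_simp; ring
      rw [e₁, e₂]
      generalize W.negY x₂ y₂ = n at *
      congr 1
      · rw [div_mul_div_comm, mul_div_assoc', eq_div_iff (by positivity)]
        simp only [b₄, b₆, b₈]
        linear_combination (-(x₁ - x₂) ^ 2) * ((y₁ - y₂ + W.a₁ * (x₁ - x₂)) * (y₁ - n) * hA +
          ((x₁ ^ 3 + W.a₂ * x₁ ^ 2 + W.a₄ * x₁ + W.a₆) -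
          (x₂ ^ 3 + W.a₂ * x₂ ^ 2 + W.a₄ * x₂ + W.a₆) - W.a₁ * (x₁ - x₂) * y₂) * hB
          - (W.a₂ + x₁ + x₂) * (x₁ - x₂) ^ 2 * hS - W.a₁ ^ 2 * (x₁ - x₂) ^ 2 * he₂)
      congr 1
      · rw [← add_div, mul_div_cancel₀ _ (pow_ne_zero 2 hd)]
        simp only [b₂, b₄, b₆]
        linear_combination -hS
      · congr 1; ring

end AddSub

end WeierstrassCurve.Affine.Point

/-! ### Splitting a known factor off a symmetric product -/

section Factor

/-- The form `h S² - g S T + f T²` vanishes at `(a, b)`, so `b S - a T` divides it; coprimality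
keeps the other factor `b' S - a' T` over `R`. -/
theorem exists_symm_factorization {R : Type*} [CommRing R] [IsDomain R] {a b f g h : R}
    (hab : IsCoprime a b) (H : h * a ^ 2 - g * a * b + f * b ^ 2 = 0) :
    ∃ a' b', f = a * a' ∧ g = a * b' + a' * b ∧ h = b * b' := by
  obtain ⟨a', ha'⟩ : a ∣ f := (hab.pow_right (n := 2)).dvd_of_dvd_mul_right
    ⟨g * b - h * a, by linear_combination H⟩
  obtain ⟨b', hb'⟩ : b ∣ h := (hab.symm.pow_right (n := 2)).dvd_of_dvd_mul_right
    ⟨g * a - f * b, by linear_combination H⟩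
  subst ha' hb'
  rcases eq_or_ne a 0 with rfl | ha
  · obtain ⟨u, hu⟩ := isUnit_iff_exists_inv.mp (isCoprime_zero_left.mp hab)
    exact ⟨g * u, b', by ring, by linear_combination (-g) * hu, rfl⟩
  rcases eq_or_ne b 0 with rfl | hb
  · obtain ⟨u, hu⟩ := isUnit_iff_exists_inv.mp (isCoprime_zero_right.mp hab)
    exact ⟨a', g * u, rfl, by linear_combination (-g) * hu, by ring⟩
  refine ⟨a', b', rfl, ?_, rfl⟩
  refine mul_left_cancel₀ (mul_ne_zero ha hb) ?_
  linear_combination -H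

end Factor

/-! ### Multiplication by `n` on `x`-coordinates -/

namespace WeierstrassCurve.Affine

open Polynomial Point

variable {K : Type*} [Field K] [DecidableEq K] (W : WeierstrassCurve.Affine K)

/-- The pair `(A, B)` of polynomials computes the `x`-coordinate of multiplication by `n`, and has
the leading terms of the pair `(Φₙ, Ψₙ²)` built from division polynomials. -/
structure IsSMulPair (n : ℕ) (A B : K[X]) : Prop where
  natDegree_left_le : A.natDegree ≤ n ^ 2
  coeff_left : A.coeff (n ^ 2) = 1
  -- Bounding `X * B` instead of `B` avoids the exponent `n ^ 2 - 1`, which truncates at `n = 0`.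
  natDegree_right_le : (X * B).natDegree ≤ n ^ 2
  coeff_right : (X * B).coeff (n ^ 2) = (n : K) ^ 2
  xRep_smul : ∀ (x y : K) (h : W.Nonsingular x y), ∃ c : K, c ≠ 0 ∧
    A.eval x = c * (n • some x y h).xRep 0 ∧ B.eval x = c * (n • some x y h).xRep 1

variable {W}

theorem isSMulPair_zero : W.IsSMulPair 0 1 0 where
  natDegree_left_le := by simp
  coeff_left := by simp
  natDegree_right_le := by simp
  coeff_right := by simp
  xRep_smul x y h := ⟨1, one_ne_zero, by simp, by simp⟩

theorem isSMulPair_one : W.IsSMulPair 1 X 1 where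
  natDegree_left_le := by simp
  coeff_left := by simp
  natDegree_right_le := by simp
  coeff_right := by simp
  xRep_smul x y h := ⟨1, one_ne_zero, by simp, by simp⟩

omit [DecidableEq K] in
theorem exists_nonsingular [IsAlgClosed K] [W.IsElliptic] (x : K) : ∃ y, W.Nonsingular x y := by
  obtain ⟨y, hy⟩ := IsAlgClosed.exists_root
    (X ^ 2 + C (W.a₁ * x + W.a₃) * X - C (x ^ 3 + W.a₂ * x ^ 2 + W.a₄ * x + W.a₆)) (by
      have : (X ^ 2 + C (W.a₁ * x + W.a₃) * X - C (x ^ 3 + W.a₂ * x ^ 2 + W.a₄ * x + W.a₆) :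
        K[X]).degree = 2 := by compute_degree!
      rw [this]; decide)
  refine ⟨y, (W.equation_iff_nonsingular).mp ((W.equation_iff x y).mpr ?_)⟩
  simp only [IsRoot, eval_sub, eval_add, eval_pow, eval_X, eval_mul, eval_C] at hy
  linear_combination hy

namespace IsSMulPair

variable {n : ℕ} {A B : K[X]}

theorem natDegree_left (h : W.IsSMulPair n A B) : A.natDegree = n ^ 2 :=
  le_antisymm h.natDegree_left_le (le_natDegree_of_ne_zero (by rw [h.coeff_left]; exact one_ne_zero))

theorem ne_zero_or [IsAlgClosed K] [W.IsElliptic] (h : W.IsSMulPair n A B) (x : K) :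
    A.eval x ≠ 0 ∨ B.eval x ≠ 0 := by
  obtain ⟨y, hy⟩ := exists_nonsingular (W := W) x
  obtain ⟨c, hc, h₁, h₂⟩ := h.xRep_smul x y hy
  by_contra! hcon
  refine xRep_ne_zero (n • some x y hy) (funext fun i => ?_)
  fin_cases i
  · exact (mul_eq_zero.mp (h₁.symm.trans hcon.1)).resolve_left hc
  · exact (mul_eq_zero.mp (h₂.symm.trans hcon.2)).resolve_left hc

theorem isCoprime [IsAlgClosed K] [W.IsElliptic] (h : W.IsSMulPair n A B) : IsCoprime A B := by
  rw [isCoprime_iff_aeval_ne_zero_of_isAlgClosed K K]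
  simpa only [coe_aeval_eq_eval] using h.ne_zero_or

/-- The points `(n + 1)P` and `P` have sum `(n + 2)P` and difference `nP`. The add-sub map therefore
gives the symmetric product of `x((n + 2)P)` and `x(nP)`, from which the coprime pair `(A₀, B₀)`
splits off. -/
theorem exists_add_two [IsAlgClosed K] [W.IsElliptic] {A₀ B₀ : K[X]} (h₀ : W.IsSMulPair n A₀ B₀)
    (h : W.IsSMulPair (n + 1) A B) : ∃ A' B', W.IsSMulPair (n + 2) A' B' := by
  -- `(s, t, B)` is the symmetric product of `(A : B)` and `(X : 1)`, representing `x((n + 1)P)` and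
  -- `x(P)`.
  set s := A * X with hs
  set t := A + X * B with ht
  have key : ∀ (x y : K) (hxy : W.Nonsingular x y), ∃ k : K, k ≠ 0 ∧
      (s ^ 2 - C W.b₄ * s * B - C W.b₆ * t * B - C W.b₈ * B ^ 2).eval x =
        k * ((n • some x y hxy).xRep 0 * ((n + 2) • some x y hxy).xRep 0) ∧
      (2 * t * s + C W.b₂ * s * B + C W.b₄ * t * B + C W.b₆ * B ^ 2).eval x =
        k * ((n • some x y hxy).xRep 0 * ((n + 2) • some x y hxy).xRep 1 +
          (n • some x y hxy).xRep 1 * ((n + 2) • some x y hxy).xRep 0) ∧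
      (t ^ 2 - 4 * s * B).eval x =
        k * ((n • some x y hxy).xRep 1 * ((n + 2) • some x y hxy).xRep 1) := by
    intro x y hxy
    obtain ⟨c, hc, h₁, h₂⟩ := h.xRep_smul x y hxy
    obtain ⟨d, hd, H⟩ := exists_addSubMap_sym2x ((n + 1) • some x y hxy) (some x y hxy)
    have e₁ : (n + 1) • some x y hxy + some x y hxy = (n + 2) • some x y hxy :=
      (succ_nsmul _ _).symm
    have e₂ : (n + 1) • some x y hxy - some x y hxy = n • some x y hxy := by
      rw [succ_nsmul, add_sub_cancel_right]
    rw [e₁, e₂, sym2x, eval_addSubMap, sym2x] at H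
    have H0 := congrFun H 0
    have H1 := congrFun H 1
    have H2 := congrFun H 2
    simp only [Matrix.cons_val_zero, Matrix.cons_val_one, Matrix.cons_val, Pi.smul_apply,
      smul_eq_mul, xRep_some, mul_one] at H0 H1 H2
    refine ⟨c ^ 2 * d, mul_ne_zero (pow_ne_zero 2 hc) hd, ?_, ?_, ?_⟩ <;>
      simp only [hs, ht, eval_sub, eval_add, eval_mul, eval_pow, eval_X, eval_C, h₁, h₂,
        eval_ofNat]
    · linear_combination c ^ 2 * H0
    · linear_combination c ^ 2 * H1
    · linear_combination c ^ 2 * H2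
  set F₀ := s ^ 2 - C W.b₄ * s * B - C W.b₆ * t * B - C W.b₈ * B ^ 2 with hF₀
  set F₁ := 2 * t * s + C W.b₂ * s * B + C W.b₄ * t * B + C W.b₆ * B ^ 2 with hF₁
  set F₂ := t ^ 2 - 4 * s * B with hF₂
  -- `x(nP)` is a root of the form with coefficients `F₂, -F₁, F₀`. Checking values suffices, since
  -- `K` is infinite and every `x` lies under a point.
  have hrel : F₂ * A₀ ^ 2 - F₁ * A₀ * B₀ + F₀ * B₀ ^ 2 = 0 := by
    refine Polynomial.funext fun x => ?_
    obtain ⟨y, hy⟩ := exists_nonsingular (W := W) x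
    obtain ⟨k, -, k₀, k₁, k₂⟩ := key x y hy
    obtain ⟨c, hc, h₁, h₂⟩ := h₀.xRep_smul x y hy
    simp only [eval_sub, eval_add, eval_mul, eval_pow, k₀, k₁, k₂, h₁, h₂, eval_zero]
    ring
  obtain ⟨A', B', f₀, f₁, f₂⟩ := exists_symm_factorization h₀.isCoprime hrel
  have dX : (X : K[X]).natDegree ≤ 1 := natDegree_X_le
  have dA := h.natDegree_left_le
  have dB : B.natDegree ≤ (n + 1) ^ 2 := by
    rcases eq_or_ne B 0 with rfl | hB
    · simp
    · have := h.natDegree_right_le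
      rw [natDegree_X_mul hB] at this
      omega
  have ds : s.natDegree ≤ (n + 1) ^ 2 + 1 := natDegree_mul_le_of_le dA dX
  have dt : t.natDegree ≤ (n + 1) ^ 2 := natDegree_add_le_of_degree_le dA h.natDegree_right_le
  have cs : s.coeff ((n + 1) ^ 2 + 1) = 1 := by rw [hs, coeff_mul_X, h.coeff_left]
  have ct : t.coeff ((n + 1) ^ 2) = 1 + ((n + 1 : ℕ) : K) ^ 2 := by
    rw [ht, coeff_add, h.coeff_left, h.coeff_right]
  have hn : n ^ 2 + (n + 2) ^ 2 = 2 * (n + 1) ^ 2 + 2 := by ring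
  set N := (n + 1) ^ 2 with hN
  have dC : ∀ {f : K[X]} {m : ℕ} (a : K), f.natDegree ≤ m → (C a * f).natDegree ≤ m :=
    fun a hf => (natDegree_C_mul_le a _).trans hf
  have dsB := natDegree_mul_le_of_le ds dB
  have dtB := natDegree_mul_le_of_le dt dB
  have dBB := natDegree_mul_le_of_le dB dB
  have dss := natDegree_mul_le_of_le ds ds
  have dts := natDegree_mul_le_of_le dt ds
  have eF₀ : F₀ = s * s - (C W.b₄ * (s * B) + C W.b₆ * (t * B) + C W.b₈ * (B * B)) := by
    rw [hF₀]; ring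
  have dr₀ : (C W.b₄ * (s * B) + C W.b₆ * (t * B) + C W.b₈ * (B * B)).natDegree < 2 * N + 2 := by
    refine (natDegree_add_le_of_degree_le (n := 2 * N + 1) (natDegree_add_le_of_degree_le
      (dC _ (dsB.trans ?_)) (dC _ (dtB.trans ?_))) (dC _ (dBB.trans ?_))).trans_lt ?_ <;> omega
  have dF₀ : F₀.natDegree ≤ 2 * N + 2 := by
    rw [eF₀]
    exact (natDegree_sub_le _ _).trans (max_le (dss.trans (by omega)) dr₀.le)
  have cF₀ : F₀.coeff (2 * N + 2) = 1 := by
    rw [eF₀, coeff_sub, coeff_eq_zero_of_natDegree_lt dr₀,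
      show 2 * N + 2 = (N + 1) + (N + 1) by ring, coeff_mul_add_eq_of_natDegree_le ds ds, cs]
    ring
  have dF₁' : (s * (X * B)).natDegree ≤ 2 * N + 1 :=
    (natDegree_mul_le_of_le ds h.natDegree_right_le).trans_eq (by ring)
  have eF₁ : X * F₁ = C 2 * (t * (s * X)) +
      (C W.b₂ * (s * (X * B)) + C W.b₄ * (t * (X * B)) + C W.b₆ * (B * (X * B))) := by
    rw [hF₁, show (C 2 : K[X]) = 2 from rfl]; ring
  have dr₁ : (C W.b₂ * (s * (X * B)) + C W.b₄ * (t * (X * B)) +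
      C W.b₆ * (B * (X * B))).natDegree < 2 * N + 2 := by
    refine (natDegree_add_le_of_degree_le (n := 2 * N + 1) (natDegree_add_le_of_degree_le
      (dC _ dF₁') (dC _ ((natDegree_mul_le_of_le dt h.natDegree_right_le).trans ?_)))
      (dC _ ((natDegree_mul_le_of_le dB h.natDegree_right_le).trans ?_))).trans_lt ?_ <;> omega
  have dsX : (s * X).natDegree ≤ N + 2 := (natDegree_mul_le_of_le ds dX).trans_eq (by ring)
  have dF₁ : (X * F₁).natDegree ≤ 2 * N + 2 := by
    rw [eF₁]
    exact natDegree_add_le_of_degree_le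
      (dC _ ((natDegree_mul_le_of_le dt dsX).trans (by omega))) dr₁.le
  have cF₁ : (X * F₁).coeff (2 * N + 2) = 2 * (1 + ((n + 1 : ℕ) : K) ^ 2) := by
    rw [eF₁, coeff_add, coeff_eq_zero_of_natDegree_lt dr₁, coeff_C_mul,
      show 2 * N + 2 = N + (N + 2) by ring, coeff_mul_add_eq_of_natDegree_le dt dsX, ct,
      coeff_mul_X, cs]
    ring
  have mA₀ : A₀.Monic := monic_of_natDegree_le_of_coeff_eq_one _ h₀.natDegree_left_le h₀.coeff_left
  have mF₀ : F₀.Monic := monic_of_natDegree_le_of_coeff_eq_one _ dF₀ cF₀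
  have mA' : A'.Monic := mA₀.of_mul_monic_left (f₀ ▸ mF₀)
  have dA' : A'.natDegree = (n + 2) ^ 2 := by
    have h₁ : F₀.natDegree = 2 * N + 2 :=
      le_antisymm dF₀ (le_natDegree_of_ne_zero (by rw [cF₀]; exact one_ne_zero))
    rw [f₀, mA₀.natDegree_mul mA', h₀.natDegree_left] at h₁
    omega
  have cA' : A'.coeff ((n + 2) ^ 2) = 1 := dA' ▸ mA'.coeff_natDegree
  have eB' : A₀ * (X * B') = X * F₁ - X * B₀ * A' := by rw [f₁]; ring
  have dB' : (X * B').natDegree ≤ (n + 2) ^ 2 := by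
    rcases eq_or_ne (X * B') 0 with h0 | h0
    · simp [h0]
    have h₁ : (A₀ * (X * B')).natDegree ≤ 2 * N + 2 := by
      rw [eB']
      exact (natDegree_sub_le _ _).trans (max_le dF₁
        ((natDegree_mul_le_of_le h₀.natDegree_right_le dA'.le).trans hn.le))
    rw [mA₀.natDegree_mul' h0, h₀.natDegree_left] at h₁
    omega
  refine ⟨A', B', dA'.le, cA', dB', ?_, fun x y hxy => ?_⟩
  -- The leading coefficient comes from `2(1 + (n + 1)²) - n² = (n + 2)²`.
  · have h₁ := coeff_mul_add_eq_of_natDegree_le h₀.natDegree_left_le dB'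
    rw [h₀.coeff_left, one_mul, eB', coeff_sub,
      coeff_mul_add_eq_of_natDegree_le h₀.natDegree_right_le dA'.le, h₀.coeff_right, cA', hn,
      cF₁] at h₁
    rw [← h₁]
    push_cast
    ring
  · obtain ⟨k, hk, k₀, k₁, k₂⟩ := key x y hxy
    obtain ⟨c, hc, h₁, h₂⟩ := h₀.xRep_smul x y hxy
    rw [f₀, eval_mul, h₁] at k₀
    rw [f₁, eval_add, eval_mul, eval_mul, h₁, h₂] at k₁
    rw [f₂, eval_mul, h₂] at k₂
    have hr := xRep_ne_zero (n • some x y hxy)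
    refine ⟨k / c, div_ne_zero hk hc, ?_⟩
    generalize ((n + 2) • some x y hxy).xRep 0 = q₀, ((n + 2) • some x y hxy).xRep 1 = q₁ at *
    have hr' : (n • some x y hxy).xRep 0 ≠ 0 ∨ (n • some x y hxy).xRep 1 ≠ 0 := by
      by_contra! hcon
      refine hr (funext fun i => ?_)
      fin_cases i
      exacts [hcon.1, hcon.2]
    generalize (n • some x y hxy).xRep 0 = r₀, (n • some x y hxy).xRep 1 = r₁ at *
    rw [div_mul_eq_mul_div, div_mul_eq_mul_div, eq_div_iff hc, eq_div_iff hc]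
    -- One of `r₀, r₁` is nonzero, and cancelling it recovers the second factor of the symmetric
    -- product.
    by_cases h0 : r₀ = 0
    · subst h0
      have h1 : r₁ ≠ 0 := hr'.resolve_left (· rfl)
      exact ⟨mul_left_cancel₀ h1 (by linear_combination k₁),
        mul_left_cancel₀ h1 (by linear_combination k₂)⟩
    · have hA : A'.eval x * c = k * q₀ := mul_left_cancel₀ h0 (by linear_combination k₀)
      exact ⟨hA, mul_left_cancel₀ h0 (by linear_combination k₁ - r₁ * hA)⟩

end IsSMulPair

theorem exists_isSMulPair [IsAlgClosed K] [W.IsElliptic] (n : ℕ) :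
    ∃ A B, W.IsSMulPair n A B := by
  induction n using Nat.twoStepInduction with
  | zero => exact ⟨_, _, isSMulPair_zero⟩
  | one => exact ⟨_, _, isSMulPair_one⟩
  | more n h₀ h₁ =>
    obtain ⟨A₀, B₀, h₀⟩ := h₀
    obtain ⟨A, B, h₁⟩ := h₁
    exact h₀.exists_add_two h₁

/-! ### Divisibility and torsion of the group of points -/

section Torsion

variable [IsAlgClosed K] [W.IsElliptic]

/-- A root of `A - x(Q) B`, whose coefficient at `n ^ 2` is 1, is the `x`-coordinate of some `P`
with `nP = ±Q`. -/
theorem exists_nsmul_eq {n : ℕ} (hn : n ≠ 0) (Q : W.Point) : ∃ P : W.Point, n • P = Q := by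
  rcases Q with _ | ⟨x₀, y₀, h₀⟩
  · exact ⟨0, by rw [smul_zero]; rfl⟩
  obtain ⟨A, B, h⟩ := exists_isSMulPair (W := W) n
  have hn2 : 0 < n ^ 2 := by positivity
  have hBc : B.coeff (n ^ 2) = 0 := by
    have := coeff_eq_zero_of_natDegree_lt (p := X * B) (n := n ^ 2 + 1)
      (h.natDegree_right_le.trans_lt (Nat.lt_succ_self _))
    rwa [coeff_X_mul] at this
  have hdeg : (A - C x₀ * B).degree ≠ 0 := by
    intro hd
    have : (A - C x₀ * B).coeff (n ^ 2) = 0 :=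
      coeff_eq_zero_of_degree_lt (hd ▸ by exact_mod_cast hn2)
    rw [coeff_sub, coeff_C_mul, hBc, h.coeff_left, mul_zero, sub_zero] at this
    exact one_ne_zero this
  obtain ⟨x, hx⟩ := IsAlgClosed.exists_root _ hdeg
  obtain ⟨y, hy⟩ := exists_nonsingular (W := W) x
  obtain ⟨c, hc, h₁, h₂⟩ := h.xRep_smul x y hy
  rw [IsRoot, eval_sub, eval_mul, eval_C, h₁, h₂] at hx
  have hx' : (n • some x y hy).xRep 0 = x₀ * (n • some x y hy).xRep 1 :=
    mul_left_cancel₀ hc (by linear_combination hx)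
  have hrep : (n • some x y hy).xRep = (some x₀ y₀ h₀).xRep := by
    generalize n • some x y hy = R at hx' ⊢
    rcases R with _ | ⟨x₁, y₁, hR⟩
    · simp [← zero_def] at hx'
    · simpa using hx'
  rcases eq_or_eq_neg_of_xRep_eq_xRep hrep with h | h
  · exact ⟨_, h⟩
  · exact ⟨-some x y hy, by rw [smul_neg, h, neg_neg]⟩

omit [IsAlgClosed K] [W.IsElliptic] in
theorem nsmul_some_eq_zero_iff {n : ℕ} {A B : K[X]} (h : W.IsSMulPair n A B) {x y : K}
    (hxy : W.Nonsingular x y) : n • some x y hxy = 0 ↔ B.eval x = 0 := by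
  obtain ⟨c, hc, -, h₂⟩ := h.xRep_smul x y hxy
  rw [h₂]
  generalize n • some x y hxy = R
  rcases R with _ | ⟨x₁, y₁, hR⟩
  · simp [← zero_def]
  · simp [hc]

/-- In characteristic zero `B` has degree `n ^ 2 - 1 > 0`, and its roots are the `x`-coordinates of
nonzero `n`-torsion points. -/
theorem exists_ne_zero_nsmul_eq_zero [CharZero K] {n : ℕ} (hn : 1 < n) :
    ∃ P : W.Point, P ≠ 0 ∧ n • P = 0 := by
  obtain ⟨A, B, h⟩ := exists_isSMulPair (W := W) n
  have hn2 : 1 < n ^ 2 := Nat.one_lt_pow two_ne_zero hn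
  have hdeg : B.degree ≠ 0 := by
    intro hd
    have : B.coeff (n ^ 2 - 1) = 0 := coeff_eq_zero_of_degree_lt (hd ▸ by exact_mod_cast (by omega))
    have hc := h.coeff_right
    rw [show n ^ 2 = n ^ 2 - 1 + 1 by omega, coeff_X_mul, this] at hc
    exact pow_ne_zero 2 (Nat.cast_ne_zero.mpr (by omega)) hc.symm
  obtain ⟨x, hx⟩ := IsAlgClosed.exists_root _ hdeg
  obtain ⟨y, hy⟩ := exists_nonsingular (W := W) x
  exact ⟨some x y hy, some_ne_zero hy, (nsmul_some_eq_zero_iff h hy).mpr hx⟩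

/-- `B` is nonzero, so it has finitely many roots, and each `x`-coordinate belongs to at most the
two points `±P`. -/
theorem finite_nsmul_eq_zero [CharZero K] {n : ℕ} (hn : n ≠ 0) :
    {P : W.Point | n • P = 0}.Finite := by
  obtain ⟨A, B, h⟩ := exists_isSMulPair (W := W) n
  have hB : B ≠ 0 := by
    rintro rfl
    have hc := h.coeff_right
    rw [mul_zero, coeff_zero] at hc
    exact pow_ne_zero 2 (Nat.cast_ne_zero.mpr hn) hc.symm
  refine ((((Polynomial.finite_setOfPred_isRoot hB).image fun x => ![x, 1]).insert ![1, 0]).preimage'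
    (f := xRep) fun b _ => ?_).subset fun P hP => ?_
  · by_cases hb : ∃ P : W.Point, P.xRep = b
    · obtain ⟨P, rfl⟩ := hb
      refine (Set.toFinite {P, -P}).subset fun Q hQ => ?_
      exact eq_or_eq_neg_of_xRep_eq_xRep hQ
    · convert Set.finite_empty
      exact Set.eq_empty_of_forall_notMem fun P hP => hb ⟨P, hP⟩
  · rcases P with _ | ⟨x, y, hxy⟩
    · exact Or.inl xRep_zero
    · exact Or.inr ⟨x, (nsmul_some_eq_zero_iff h hxy).mp hP, (xRep_some hxy).symm⟩

end Torsion

end WeierstrassCurve.Affine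

/-! ### Lifting a mod `p` basis to a `ℤ_[p]`-basis -/

section Padic

variable {p : ℕ} [Fact p.Prime] {T V : Type*} [AddCommGroup T] [Module ℤ_[p] T]
  [AddCommGroup V] [Module (ZMod p) V]

/-- Write `z` as a natural number plus `p w`; the second part dies because `p` kills `V`. -/
theorem AddMonoidHom.map_padicInt_smul (π : T →+ V) (z : ℤ_[p]) (a : T) :
    π (z • a) = PadicInt.toZMod z • π a := by
  have h : z - ((PadicInt.toZMod z).val : ℤ_[p]) ∈ IsLocalRing.maximalIdeal ℤ_[p] := by
    rw [← PadicInt.ker_toZMod, RingHom.mem_ker, map_sub, map_natCast,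
      ZMod.natCast_zmod_val, sub_self]
  rw [PadicInt.maximalIdeal_eq_span_p, Ideal.mem_span_singleton] at h
  obtain ⟨w, hw⟩ := h
  have hz : z = ((PadicInt.toZMod z).val : ℤ_[p]) + p * w := by rw [← hw]; ring
  conv_lhs => rw [hz, add_smul, mul_smul, Nat.cast_smul_eq_nsmul, Nat.cast_smul_eq_nsmul, map_add,
    map_nsmul, map_nsmul]
  rw [← Nat.cast_smul_eq_nsmul (ZMod p) p, CharP.cast_eq_zero, zero_smul, add_zero,
    ← Nat.cast_smul_eq_nsmul (ZMod p), ZMod.natCast_zmod_val]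

theorem PadicInt.isPrecomplete_pi (ι : Type*) :
    IsPrecomplete (Ideal.span {(p : ℤ_[p])}) (ι → ℤ_[p]) where
  prec' f hf := by
    have hmem : ∀ (n : ℕ) (x : ι → ℤ_[p]), x ∈ (Ideal.span {(p : ℤ_[p])} ^ n • ⊤ :
        Submodule ℤ_[p] (ι → ℤ_[p])) ↔ ∀ i, (p : ℤ_[p]) ^ n ∣ x i := by
      intro n x
      rw [Ideal.span_singleton_pow, Submodule.ideal_span_singleton_smul]
      constructor
      · rintro ⟨w, -, rfl⟩ i
        exact ⟨w i, rfl⟩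
      · intro h
        choose w hw using h
        exact ⟨w, trivial, (funext hw).symm⟩
    have := fun i => (IsAdicComplete.toIsPrecomplete (I := IsLocalRing.maximalIdeal ℤ_[p])
      (M := ℤ_[p])).prec' (fun n => f n i) (by
        intro m n hmn
        have := hf hmn
        rw [SModEq.sub_mem, hmem] at this
        rw [SModEq.sub_mem, PadicInt.maximalIdeal_eq_span_p, Ideal.span_singleton_pow, smul_eq_mul,
          Ideal.mul_top, Ideal.mem_span_singleton]
        exact this i)
    choose L hL using this
    refine ⟨L, fun n => ?_⟩
    rw [SModEq.sub_mem, hmem]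
    intro i
    have := hL i n
    rwa [SModEq.sub_mem, PadicInt.maximalIdeal_eq_span_p, Ideal.span_singleton_pow, smul_eq_mul,
          Ideal.mul_top, Ideal.mem_span_singleton] at this

/-- A Nakayama argument without assuming `T` finitely generated. A relation among lifts is divisible
by `p`; dividing repeatedly, as `T` has no `p`-torsion, makes it zero. The lifts span modulo `p`,
hence span, since the free module is complete and `T` is separated. -/
theorem exists_basis_lift [Finite V] (π : T →+ V) (hπ : Function.Surjective π)
    (hker : ∀ a, π a = 0 → ∃ b, a = (p : ℤ_[p]) • b) (htf : ∀ a : T, (p : ℤ_[p]) • a = 0 → a = 0)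
    (hT : ∀ a : T, (∀ n : ℕ, ∃ b, a = (p : ℤ_[p]) ^ n • b) → a = 0) :
    ∃ (d : ℕ) (b : Module.Basis (Fin d) ℤ_[p] T) (v : Module.Basis (Fin d) (ZMod p) V),
      ∀ i, π (b i) = v i := by
  have : Module.Finite (ZMod p) V := Module.Finite.of_finite
  let v := Module.finBasis (ZMod p) V
  choose t ht using fun i => hπ (v i)
  let f : (Fin (Module.finrank (ZMod p) V) → ℤ_[p]) →ₗ[ℤ_[p]] T := Fintype.linearCombination ℤ_[p] t
  have hf : ∀ z, f z = ∑ i, z i • t i := fun z => rfl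
  have hπf : ∀ z, π (f z) = ∑ i, PadicInt.toZMod (z i) • v i := fun z => by
    rw [hf, map_sum]
    exact Finset.sum_congr rfl fun i _ => by rw [AddMonoidHom.map_padicInt_smul, ht]
  have hinj : ∀ (n : ℕ) z, f z = 0 → ∀ i, (p : ℤ_[p]) ^ n ∣ z i := by
    intro n
    induction n with
    | zero => simp
    | succ n ih =>
      intro z hz
      have h0 : ∀ i, PadicInt.toZMod (z i) = 0 :=
        Fintype.linearIndependent_iff.mp v.linearIndependent _ (by rw [← hπf, hz, map_zero])
      have h1 : ∀ i, ∃ w, z i = p * w := fun i => by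
        have := (RingHom.mem_ker).mpr (h0 i)
        rwa [PadicInt.ker_toZMod, PadicInt.maximalIdeal_eq_span_p, Ideal.mem_span_singleton] at this
      choose w hw using h1
      have hzw : z = (p : ℤ_[p]) • w := funext hw
      rw [hzw, map_smul] at hz
      intro i
      rw [hw, pow_succ']
      exact mul_dvd_mul_left _ (ih w (htf _ hz) i)
  have hfi : Function.Injective f := by
    rw [injective_iff_map_eq_zero]
    intro z hz
    funext i
    refine IsHausdorff.haus (I := IsLocalRing.maximalIdeal ℤ_[p]) inferInstance _ fun n => ?_
    rw [SModEq.zero, PadicInt.maximalIdeal_eq_span_p, Ideal.span_singleton_pow, smul_eq_mul,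
      Ideal.mul_top, Ideal.mem_span_singleton]
    exact hinj n z hz i
  have hfs : Function.Surjective f := by
    have : IsHausdorff (Ideal.span {(p : ℤ_[p])}) T := ⟨fun a ha => hT a fun n => by
      have := ha n
      rw [SModEq.zero, Ideal.span_singleton_pow, Submodule.ideal_span_singleton_smul] at this
      obtain ⟨b, -, hb⟩ := this
      exact ⟨b, hb.symm⟩⟩
    have := PadicInt.isPrecomplete_pi (p := p) (Fin (Module.finrank (ZMod p) V))
    refine surjective_of_mkQ_comp_surjective (I := Ideal.span {(p : ℤ_[p])}) fun q => ?_
    obtain ⟨a, rfl⟩ := Submodule.mkQ_surjective _ q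
    choose z hz using fun i => ZMod.ringHom_surjective (PadicInt.toZMod (p := p)) (v.repr (π a) i)
    refine ⟨z, ?_⟩
    have h0 : π (f z - a) = 0 := by
      rw [map_sub, hπf]
      simp only [hz, v.sum_repr, sub_self]
    obtain ⟨b, hb⟩ := hker _ h0
    rw [LinearMap.comp_apply, Submodule.mkQ_apply, Submodule.mkQ_apply, Submodule.Quotient.eq, hb,
      Submodule.ideal_span_singleton_smul]
    exact ⟨b, trivial, rfl⟩
  let e := LinearEquiv.ofBijective f ⟨hfi, hfs⟩
  refine ⟨_, Module.Basis.ofEquivFun e.symm, v, fun i => ?_⟩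
  rw [Module.Basis.coe_ofEquivFun]
  rw [← ht]
  congr 1
  exact (Fintype.linearCombination_apply_single ℤ_[p] t i 1).trans (one_smul _ _)

end Padic

/-! ### Absolute irreducibility from transvections -/

namespace TateGalois

section AbsolutelyIrreducible

universe u v w

/-- If `w` in a stable subspace has nonzero `i`-th coordinate, then `g w - w` is a nonzero multiple
of `c j`. The transvections keep their shape over `L`, so the argument is uniform in `L`. -/
theorem isAbsolutelyIrreducible_of_transvections {k : Type u} {G : Type v} {V : Type w} [Field k]
    [Monoid G] [AddCommGroup V] [Module k V] [Nontrivial V]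
    (ρ : Representation k G V) {ι : Type*} [Finite ι]
    [DecidableEq ι] (b : Module.Basis ι k V)
    (h : ∀ i j, i ≠ j → ∃ g, ∀ l, ρ g (b l) = b l + if l = i then b j else 0) :
    IsAbsolutelyIrreducible ρ := by
  intro L _ _
  let c := b.baseChange L
  have hc : ∀ i j, i ≠ j → ∃ g, ∀ w, baseChangeRep ρ L g w = w + c.coord i w • c j := by
    intro i j hij
    obtain ⟨g, hg⟩ := h i j hij
    refine ⟨g, fun w => ?_⟩
    have : baseChangeRep ρ L g = LinearMap.id + (c.coord i).smulRight (c j) := by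
      refine c.ext fun l => ?_
      have h₁ : baseChangeRep ρ L g (c l) = 1 ⊗ₜ[k] (ρ g (b l)) := by
        rw [Module.Basis.baseChange_apply]; rfl
      rw [h₁, hg, TensorProduct.tmul_add, ← Module.Basis.baseChange_apply (S := L) b l]
      rw [LinearMap.add_apply, LinearMap.smulRight_apply, LinearMap.id_apply,
        Module.Basis.coord_apply, Module.Basis.repr_self, Finsupp.single_apply]
      split_ifs
      · rw [one_smul, ← Module.Basis.baseChange_apply (S := L) b j]
      · rw [zero_smul, TensorProduct.tmul_zero]
    rw [this]; rfl
  have : Nonempty ι := b.index_nonempty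
  have hV : Nontrivial (L ⊗[k] V) := ⟨c (Classical.arbitrary ι), 0, c.ne_zero _⟩
  refine { exists_pair_ne := ⟨⊥, ⊤, fun hbt => ?_⟩, eq_bot_or_eq_top := fun U => ?_ }
  · exact bot_ne_top (congrArg Subrepresentation.toSubmodule hbt)
  · by_cases hU : U.toSubmodule = ⊥
    · exact Or.inl (Subrepresentation.toSubmodule_injective hU)
    refine Or.inr (Subrepresentation.toSubmodule_injective ?_)
    obtain ⟨w, hw, hw0⟩ := Submodule.exists_mem_ne_zero_of_ne_bot hU
    have step : ∀ i j, i ≠ j → ∀ w ∈ U.toSubmodule, c.coord i w ≠ 0 → c j ∈ U.toSubmodule := by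
      intro i j hij w hw hwi
      obtain ⟨g, hg⟩ := hc i j hij
      have := U.toSubmodule.sub_mem (U.apply_mem_toSubmodule g hw) hw
      rw [hg, add_sub_cancel_left] at this
      exact (U.toSubmodule.smul_mem_iff hwi).mp this
    obtain ⟨i, hi⟩ : ∃ i, c.coord i w ≠ 0 := by
      by_contra! hcon
      exact hw0 (c.ext_elem fun i => by simpa using hcon i)
    have hall : ∀ j, c j ∈ U.toSubmodule := by
      intro j
      by_cases hij : i = j
      · subst hij
        -- `c i` itself is reached by going to another `c m` and back; with no other index the space
        -- is a line.
        by_cases hex : ∃ m, i ≠ m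
        · obtain ⟨m, hm⟩ := hex
          refine step m i hm.symm (c m) (step i m hm w hw hi) ?_
          simp
        · push Not at hex
          have hwc : w = c.coord i w • c i := by
            refine c.ext_elem fun l => ?_
            obtain rfl := hex l
            simp
          rw [hwc] at hw
          exact (U.toSubmodule.smul_mem_iff hi).mp hw
      · exact step i j hij w hw hi
    change U.toSubmodule = ⊤
    rw [eq_top_iff, ← c.span_eq, Submodule.span_le]
    rintro _ ⟨j, rfl⟩
    exact hall j

end AbsolutelyIrreducible

end TateGalois

/-! ### The Tate module and its projection to the `p`-torsion -/

namespace TateGalois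

section TateModule

variable {p : ℕ} [Fact p.Prime] {A : Type*} [AddCommGroup A]

theorem coe_natCast_smul (k : ℕ) (a : tateModule p A) (n : ℕ) :
    ((k : ℤ_[p]) • a).1 n = k • a.1 n := by
  rw [Nat.cast_smul_eq_nsmul]; rfl

theorem coe_pow_smul (m : ℕ) (a : tateModule p A) (n : ℕ) :
    ((p : ℤ_[p]) ^ m • a).1 n = p ^ m • a.1 n := by
  rw [← Nat.cast_pow, coe_natCast_smul]

theorem eq_zero_of_smul_eq_zero (a : tateModule p A) (h : (p : ℤ_[p]) • a = 0) : a = 0 := by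
  refine Subtype.ext (funext fun n => ?_)
  rw [← (a.2 n).2, ← coe_natCast_smul, h]
  rfl

theorem eq_zero_of_forall_pow_smul (a : tateModule p A)
    (h : ∀ n : ℕ, ∃ b, a = (p : ℤ_[p]) ^ n • b) : a = 0 := by
  refine Subtype.ext (funext fun n => ?_)
  obtain ⟨b, rfl⟩ := h n
  rw [coe_pow_smul, (b.2 n).1]
  rfl

omit [Fact p.Prime] in
theorem pow_nsmul_coe_add (a : tateModule p A) (m n : ℕ) : p ^ m • a.1 (m + n) = a.1 n := by
  induction m with
  | zero => simp
  | succ m ih => rw [pow_succ, mul_smul, Nat.add_right_comm, (a.2 _).2, ih]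

/-- Shifting the sequence by one divides it by `p`; the vanishing of the first component gives the
shifted terms the right torsion order. -/
theorem exists_eq_smul_of_coe_one_eq_zero (a : tateModule p A) (h : a.1 1 = 0) :
    ∃ b, a = (p : ℤ_[p]) • b := by
  refine ⟨⟨fun n => a.1 (n + 1), fun n => ⟨?_, (a.2 _).2⟩⟩, Subtype.ext (funext fun n => ?_)⟩
  · rw [pow_nsmul_coe_add a n 1, h]
  · rw [coe_natCast_smul, (a.2 n).2]

omit [Fact p.Prime] in
theorem exists_coe_one_eq (hdiv : ∀ x : A, ∃ y, p • y = x) {x : A} (hx : p • x = 0) :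
    ∃ a : tateModule p A, a.1 1 = x := by
  choose g hg using hdiv
  have hx' : ∀ n, p ^ (n + 1) • g^[n] x = 0 := by
    intro n
    induction n with
    | zero => simpa using hx
    | succ n ih => rw [Function.iterate_succ_apply', pow_succ, mul_smul, hg, ih]
  -- The component at 0 lies in `A[1] = 0`, so `x` sits at index 1 and its iterated `p`-th parts
  -- follow.
  refine ⟨⟨fun n => n.casesOn 0 fun m => g^[m] x, fun n => ?_⟩, rfl⟩
  cases n with
  | zero => exact ⟨by simp, hx⟩
  | succ n => exact ⟨hx' n, by simp only [Function.iterate_succ_apply', hg]⟩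

/-- The projection of the Tate module onto the `p`-torsion. -/
def tateProj (p : ℕ) (A : Type*) [AddCommGroup A] :
    tateModule p A →+ AddSubgroup.torsionBy A (p : ℤ) :=
  ((Pi.evalAddMonoidHom (fun _ : ℕ => A) 1).comp (tateModule p A).subtype).codRestrict _ fun a => by
    have := (a.2 1).1
    rw [pow_one] at this
    change (p : ℤ) • a.1 1 = 0
    rwa [natCast_zsmul]

end TateModule

/-! ### Commutators fix the cyclotomic tower -/

section Commutator

theorem commutator_apply_root_of_unity {K L : Type*} [Field K] [Field L] [Algebra K L]
    (σ τ : L ≃ₐ[K] L) {n : ℕ} (hn : n ≠ 0) {ζ : L} (hζ : ζ ^ n = 1) :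
    (σ * τ * σ⁻¹ * τ⁻¹) ζ = ζ := by
  have : NeZero n := ⟨hn⟩
  have key : ∀ (σ : L ≃ₐ[K] L) (ξ : L), ξ ^ n = 1 → ∃ m : ℕ, σ ξ = ξ ^ m := fun σ ξ hξ =>
    map_rootsOfUnity_eq_pow_self σ (rootsOfUnity.mkOfPowEq ξ hξ)
  have hcomm : ∀ ξ : L, ξ ^ n = 1 → σ (τ ξ) = τ (σ ξ) := fun ξ hξ => by
    obtain ⟨a, ha⟩ := key σ ξ hξ
    obtain ⟨b, hb⟩ := key τ ξ hξ
    rw [hb, ha, map_pow, map_pow, ha, hb, ← pow_mul, ← pow_mul, mul_comm]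
  change σ (τ (σ.symm (τ.symm ζ))) = ζ
  rw [hcomm, AlgEquiv.apply_symm_apply, AlgEquiv.apply_symm_apply]
  rw [← map_pow, ← map_pow, hζ, map_one, map_one]

theorem commutator_mem_fixingSubgroup_cyclotomicTower {p : ℕ} (hp : p ≠ 0) (σ τ : GQ) :
    σ * τ * σ⁻¹ * τ⁻¹ ∈ (cyclotomicTower p).fixingSubgroup := by
  rw [IntermediateField.mem_fixingSubgroup_iff]
  intro x hx
  induction hx using IntermediateField.adjoin_induction with
  | mem ζ hζ =>
    obtain ⟨n, hn⟩ := hζ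
    exact commutator_apply_root_of_unity σ τ (pow_ne_zero n hp) hn
  | algebraMap q => exact AlgEquiv.commutes _ q
  | add x y _ _ hx hy => rw [map_add, hx, hy]
  | inv x _ hx => rw [map_inv₀, hx]
  | mul x y _ _ hx hy => rw [map_mul, hx, hy]

end Commutator

/-! ### Transvections as commutators -/

section Transvection

variable {R M ι : Type*} [CommRing R] [AddCommGroup M] [Module R M] [DecidableEq ι]

theorem exists_commutator_eq_transvection (b : Module.Basis ι R M) {u : R} (hu : 2 * u = 1)
    {i j : ι} (hij : i ≠ j) :
    ∃ D e : M ≃ₗ[R] M, ∀ l, (D * e * D⁻¹ * e⁻¹) (b l) = b l + if l = i then b j else 0 := by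
  have hi : b.coord i (b j) = 0 := by simp [hij.symm]
  have hj : b.coord j (b j) = 1 := by simp
  -- `D` scales `b j` by 2 and its inverse scales it by `u`, the inverse of 2.
  let D : M ≃ₗ[R] M := LinearEquiv.ofLinearMap (LinearMap.id + (b.coord j).smulRight (b j))
    (LinearMap.id + (u - 1) • (b.coord j).smulRight (b j)) (by
      refine LinearMap.ext fun a => ?_
      change (a + (u - 1) • b.coord j a • b j) +
        b.coord j (a + (u - 1) • b.coord j a • b j) • b j = a
      rw [map_add, map_smul, map_smul, hj, smul_eq_mul, smul_eq_mul, smul_smul, add_assoc,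
        ← add_smul, add_eq_left]
      convert zero_smul R (b j)
      linear_combination b.coord j a * hu) (by
      refine LinearMap.ext fun a => ?_
      change (a + b.coord j a • b j) + (u - 1) • b.coord j (a + b.coord j a • b j) • b j = a
      rw [map_add, map_smul, hj, smul_eq_mul, smul_smul, add_assoc, ← add_smul, add_eq_left]
      convert zero_smul R (b j)
      linear_combination b.coord j a * hu)
  let e : M ≃ₗ[R] M := LinearEquiv.ofLinearMap (LinearMap.id + (b.coord i).smulRight (b j))
    (LinearMap.id - (b.coord i).smulRight (b j)) (by
      refine LinearMap.ext fun a => ?_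
      change (a - b.coord i a • b j) + b.coord i (a - b.coord i a • b j) • b j = a
      rw [map_sub, map_smul, hi, smul_zero, sub_zero, sub_add_cancel]) (by
      refine LinearMap.ext fun a => ?_
      change (a + b.coord i a • b j) - b.coord i (a + b.coord i a • b j) • b j = a
      rw [map_add, map_smul, hi, smul_zero, add_zero, add_sub_cancel_right])
  refine ⟨D, e, fun l => ?_⟩
  have h₂ : ∀ a, D a = a + b.coord j a • b j := fun a => rfl
  have h₁ : ∀ a, e a = a + b.coord i a • b j := fun a => rfl
  have h : D * e = e * e * D := by
    refine LinearEquiv.ext fun a => ?_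
    change D (e a) = e (e (D a))
    simp only [h₂, h₁, map_add, map_smul, hi, hj, smul_eq_mul, mul_zero, mul_one, add_zero,
      add_smul]
    abel
  rw [h, mul_inv_cancel_right, mul_inv_cancel_right, h₁]
  simp [Finsupp.single_apply]

end Transvection

/-! ### Application to elliptic curves -/

instance isElliptic_baseChange_QBar (E : WeierstrassCurve ℚ) [E.IsElliptic] :
    WeierstrassCurve.IsElliptic (E⁄QBar) :=
  inferInstanceAs (E.map (algebraMap ℚ QBar)).IsElliptic

/-- Surjectivity lifts both entries of the commutator to `GQ`. The commutator of the lifts fixes the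
cyclotomic tower and, by equivariance of `tateProj`, acts on `E[p]` as the reduced transvection. -/
theorem exists_cyclotomic_transvection (E : WeierstrassCurve ℚ) (p : ℕ) [Fact p.Prime]
    (hp : Odd p) (hsurj : Function.Surjective (pAdicRep E p)) {ι : Type*} [DecidableEq ι]
    (b : Module.Basis ι ℤ_[p] (tateModule p (GeomPoint E))) {i j : ι} (hij : i ≠ j) :
    ∃ g, ∀ l, modPRepCyclotomic E p g (tateProj p _ (b l)) =
      tateProj p _ (b l) + if l = i then tateProj p _ (b j) else 0 := by
  have h2 : IsUnit (2 : ℤ_[p]) := by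
    rw [PadicInt.isUnit_iff]
    exact PadicInt.norm_natCast_eq_one_iff.mpr (Nat.coprime_two_right.mpr hp)
  obtain ⟨u, hu⟩ := isUnit_iff_exists_inv.mp h2
  obtain ⟨D, e, hDe⟩ := exists_commutator_eq_transvection b hu hij
  obtain ⟨σ, rfl⟩ := hsurj D
  obtain ⟨τ, rfl⟩ := hsurj e
  refine ⟨⟨_, commutator_mem_fixingSubgroup_cyclotomicTower (Fact.out : p.Prime).ne_zero σ τ⟩,
    fun l => ?_⟩
  have h₁ : ∀ (g : GQ) (a : tateModule p (GeomPoint E)),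
      modPRep E p g (tateProj p _ a) = tateProj p _ (pAdicRep E p g a) := fun g a => rfl
  change modPRep E p (σ * τ * σ⁻¹ * τ⁻¹) _ = _
  rw [h₁, map_mul, map_mul, map_mul, map_inv, map_inv, hDe, map_add]
  split_ifs <;> simp

theorem isAbsolutelyIrreducible_modPRepCyclotomic (E : WeierstrassCurve ℚ) [E.IsElliptic] (p : ℕ)
    [Fact p.Prime] (hp : Odd p) (hsurj : Function.Surjective (pAdicRep E p)) :
    IsAbsolutelyIrreducible (modPRepCyclotomic E p) := by
  have hpp : p.Prime := Fact.out
  have : Finite (torsionP E p) := by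
    refine ((WeierstrassCurve.Affine.finite_nsmul_eq_zero (W := E⁄QBar) hpp.ne_zero).subset
      fun P hP => ?_).to_subtype
    exact (natCast_zsmul P p).symm.trans hP
  have : Nontrivial (torsionP E p) := by
    obtain ⟨P, hP, hP0⟩ := WeierstrassCurve.Affine.exists_ne_zero_nsmul_eq_zero (W := E⁄QBar)
      hpp.one_lt
    exact ⟨⟨P, (natCast_zsmul P p).trans hP0⟩, 0, fun h => hP (congrArg Subtype.val h)⟩
  obtain ⟨d, b, v, hv⟩ := exists_basis_lift (p := p) (tateProj p (GeomPoint E))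
    (fun x => (exists_coe_one_eq (WeierstrassCurve.Affine.exists_nsmul_eq hpp.ne_zero)
      ((natCast_zsmul x.1 p).symm.trans x.2)).imp fun a ha => Subtype.ext ha)
    (fun a ha => exists_eq_smul_of_coe_one_eq_zero a (congrArg Subtype.val ha))
    eq_zero_of_smul_eq_zero eq_zero_of_forall_pow_smul
  refine isAbsolutelyIrreducible_of_transvections _ v fun i j hij => ?_
  simpa only [hv] using exists_cyclotomic_transvection E p hp hsurj b hij

end TateGalois

theorem mainTheorem11 (E : WeierstrassCurve ℚ) [E.IsElliptic] (p : ℕ) [Fact p.Prime]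
    (hp : Odd p) (hsurj : Function.Surjective (TateGalois.pAdicRep E p)) :
    TateGalois.IsAbsolutelyIrreducible (TateGalois.modPRepCyclotomic E p) :=
  TateGalois.isAbsolutelyIrreducible_modPRepCyclotomic E p hp hsurj
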